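/- Let $n\ge 4$ be an integer and let $\rho\in M_4(\mathbb{C})\otimes M_n(\mathbb{C})$ be a mixed state on $\mathbb{C}^4\otimes\mathbb{C}^n$, i.e. a positive semidefinite Hermitian matrix with $\operatorname{Tr}\rho=1$. Let $\lambda_1\ge\lambda_2\ge\dots\ge\lambda_{4n}$ be its eigenvalues, counted with multiplicity, in decreasing order. For $X=\sum x_{ijkl}\,|i\rangle\langle j|\otimes|k\rangle\langle l|$ write $X^{\Gamma}=\sum x_{ijkl}\,|i\rangle\langle j|\otimes|l\rangle\langle k|$ for the partial transpose with respect to the second factor. Call $\rho$ absolutely PPT if $(U\rho U^\dagger)^{\Gamma}$ is positive semidefinite for every unitary $4n\times 4n$ matrix $U$. Then $\rho$ is absolutely PPT if and only if the following twelve real symmetric $4\times4$ matrices $\Lambda_1,\dots,\Lambda_{12}$ are all positive semidefinite, where $b_j=\lambda_{4n-j}$ for $0\le j\le 9$ and $a_j=\lambda_j$ for $1\le j\le 6$: $$\Lambda_{1}=\begin{bmatrix}2b_0& b_1-a_1& b_2-a_2& b_3-a_3\\ b_1-a_1& 2b_4& b_5-a_4& b_6-a_5\\ b_2-a_2& b_5-a_4&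 2b_7& b_8-a_6\\ b_3-a_3& b_6-a_5 & b_8-a_6 & 2b_9\end{bmatrix},$$ $$\Lambda_{2}=\begin{bmatrix}2b_0& b_1-a_1& b_2-a_2& b_3-a_3\\ b_1-a_1& 2b_4& b_5-a_4& b_7-a_5\\ b_2-a_2& b_5-a_4& 2b_6& b_8-a_6\\ b_3-a_3& b_7-a_5 & b_8-a_6 & 2b_9\end{bmatrix},$$ $$\Lambda_{3}=\begin{bmatrix}2b_0& b_1-a_1& b_2-a_2& b_6-a_4\\ b_1-a_1& 2b_3& b_4-a_3& b_7-a_5\\ b_2-a_2& b_4-a_3& 2b_5& b_8-a_6\\ b_6-a_4& b_7-a_5 & b_8-a_6 & 2b_9\end{bmatrix},$$ $$\Lambda_{4}=\begin{bmatrix}2b_0& b_1-a_1& b_3-a_2& b_6-a_4\\ b_1-a_1& 2b_2& b_4-a_3& b_7-a_5\\ b_3-a_2& b_4-a_3& 2b_5& b_8-a_6\\ b_6-a_4& b_7-a_5 & b_8-a_6 & 2b_9\end{bmatrix},$$ $$\Lambda_{5}=\begin{bmatrix}2b_0& b_1-a_1& b_2-a_2& b_5-a_4\\ b_1-a_1&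 2b_3& b_4-a_3& b_7-a_5\\ b_2-a_2& b_4-a_3& 2b_6& b_8-a_6\\ b_5-a_4& b_7-a_5 & b_8-a_6 & 2b_9\end{bmatrix},$$ $$\Lambda_{6}=\begin{bmatrix}2b_0& b_1-a_1& b_3-a_2& b_5-a_4\\ b_1-a_1& 2b_2& b_4-a_3& b_7-a_5\\ b_3-a_2& b_4-a_3& 2b_6& b_8-a_6\\ b_5-a_4& b_7-a_5 & b_8-a_6 & 2b_9\end{bmatrix},$$ $$\Lambda_{7}=\begin{bmatrix}2b_0& b_1-a_1& b_2-a_2& b_5-a_4\\ b_1-a_1& 2b_3& b_4-a_3& b_6-a_5\\ b_2-a_2& b_4-a_3& 2b_7& b_8-a_6\\ b_5-a_4& b_6-a_5 & b_8-a_6 & 2b_9\end{bmatrix},$$ $$\Lambda_{8}=\begin{bmatrix}2b_0& b_1-a_1& b_3-a_2& b_5-a_4\\ b_1-a_1& 2b_2& b_4-a_3& b_6-a_5\\ b_3-a_2& b_4-a_3& 2b_7& b_8-a_6\\ b_5-a_4& b_6-a_5 & b_8-a_6 & 2b_9\end{bmatrix},$$ $$\Lambda_{9}=\begin{bmatrix}2b_0&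 b_1-a_1& b_2-a_2& b_4-a_3\\ b_1-a_1& 2b_3& b_5-a_4& b_7-a_5\\ b_2-a_2& b_5-a_4& 2b_6& b_8-a_6\\ b_4-a_3& b_7-a_5 & b_8-a_6 & 2b_9\end{bmatrix},$$ $$\Lambda_{10}=\begin{bmatrix}2b_0& b_1-a_1& b_3-a_2& b_4-a_3\\ b_1-a_1& 2b_2& b_5-a_4& b_7-a_5\\ b_3-a_2& b_5-a_4& 2b_6& b_8-a_6\\ b_4-a_3& b_7-a_5 & b_8-a_6 & 2b_9\end{bmatrix},$$ $$\Lambda_{11}=\begin{bmatrix}2b_0& b_1-a_1& b_2-a_2& b_4-a_3\\ b_1-a_1& 2b_3& b_5-a_4& b_6-a_5\\ b_2-a_2& b_5-a_4& 2b_7& b_8-a_6\\ b_4-a_3& b_6-a_5 & b_8-a_6 & 2b_9\end{bmatrix},$$ $$\Lambda_{12}=\begin{bmatrix}2b_0& b_1-a_1& b_3-a_2& b_4-a_3\\ b_1-a_1& 2b_2& b_5-a_4& b_6-a_5\\ b_3-a_2& b_5-a_4& 2b_7& b_8-a_6\\ b_4-a_3& b_6-a_5 & b_8-a_6 & 2b_9\end{bmatrix}.$$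 -/

import Mathlib

open scoped ComplexOrder

/-- A mixed state of `ℂ^m ⊗ ℂ^n`: a positive semidefinite matrix of trace one. The pair `(i, k)`
indexes the product basis vector `e_i ⊗ e_k`. -/
def IsMixedState {m n : ℕ} (ρ : Matrix (Fin m × Fin n) (Fin m × Fin n) ℂ) : Prop :=
  ρ.PosSemidef ∧ ρ.trace = 1

/-- The partial transpose with respect to the second tensor factor. -/
def partialTranspose {m n : ℕ} (ρ : Matrix (Fin m × Fin n) (Fin m × Fin n) ℂ) :
    Matrix (Fin m × Fin n) (Fin m × Fin n) ℂ :=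
  Matrix.of fun r c => ρ (r.1, c.2) (c.1, r.2)

/-- Positive partial transpose. -/
def IsPPT {m n : ℕ} (ρ : Matrix (Fin m × Fin n) (Fin m × Fin n) ℂ) : Prop :=
  (partialTranspose ρ).PosSemidef

/-- Absolutely PPT: every global unitary conjugate is PPT. -/
def IsAbsolutelyPPT {m n : ℕ} (ρ : Matrix (Fin m × Fin n) (Fin m × Fin n) ℂ) : Prop :=
  ∀ U ∈ Matrix.unitaryGroup (Fin m × Fin n) ℂ, IsPPT (U * ρ * U.conjTranspose)

/-- `lam 1, …, lam N` lists the eigenvalues of `A` with multiplicity, in decreasing order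
(no other value of `lam` matters). -/
def IsDecreasingSpectrum {ι : Type*} [Fintype ι] [DecidableEq ι] (A : Matrix ι ι ℂ)
    (N : ℕ) (lam : ℕ → ℝ) : Prop :=
  AntitoneOn lam (Set.Icc 1 N) ∧
    A.charpoly = ∏ k ∈ Finset.Icc 1 N, (Polynomial.X - Polynomial.C (lam k : ℂ))

/-- The twelve symmetric patterns, `a j` being the `j`-th largest eigenvalue and `b j` the one `j`
places before the smallest. -/
def lambdaPattern (a b : ℕ → ℝ) : Fin 12 → Matrix (Fin 4) (Fin 4) ℝ
  | 0 =>
      !![2 * b 0, b 1 - a 1, b 2 - a 2, b 3 - a 3;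
        b 1 - a 1, 2 * b 4, b 5 - a 4, b 6 - a 5;
        b 2 - a 2, b 5 - a 4, 2 * b 7, b 8 - a 6;
        b 3 - a 3, b 6 - a 5, b 8 - a 6, 2 * b 9]
  | 1 =>
      !![2 * b 0, b 1 - a 1, b 2 - a 2, b 3 - a 3;
        b 1 - a 1, 2 * b 4, b 5 - a 4, b 7 - a 5;
        b 2 - a 2, b 5 - a 4, 2 * b 6, b 8 - a 6;
        b 3 - a 3, b 7 - a 5, b 8 - a 6, 2 * b 9]
  | 2 =>
      !![2 * b 0, b 1 - a 1, b 2 - a 2, b 6 - a 4;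
        b 1 - a 1, 2 * b 3, b 4 - a 3, b 7 - a 5;
        b 2 - a 2, b 4 - a 3, 2 * b 5, b 8 - a 6;
        b 6 - a 4, b 7 - a 5, b 8 - a 6, 2 * b 9]
  | 3 =>
      !![2 * b 0, b 1 - a 1, b 3 - a 2, b 6 - a 4;
        b 1 - a 1, 2 * b 2, b 4 - a 3, b 7 - a 5;
        b 3 - a 2, b 4 - a 3, 2 * b 5, b 8 - a 6;
        b 6 - a 4, b 7 - a 5, b 8 - a 6, 2 * b 9]
  | 4 =>
      !![2 * b 0, b 1 - a 1, b 2 - a 2, b 5 - a 4;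
        b 1 - a 1, 2 * b 3, b 4 - a 3, b 7 - a 5;
        b 2 - a 2, b 4 - a 3, 2 * b 6, b 8 - a 6;
        b 5 - a 4, b 7 - a 5, b 8 - a 6, 2 * b 9]
  | 5 =>
      !![2 * b 0, b 1 - a 1, b 3 - a 2, b 5 - a 4;
        b 1 - a 1, 2 * b 2, b 4 - a 3, b 7 - a 5;
        b 3 - a 2, b 4 - a 3, 2 * b 6, b 8 - a 6;
        b 5 - a 4, b 7 - a 5, b 8 - a 6, 2 * b 9]
  | 6 =>
      !![2 * b 0, b 1 - a 1, b 2 - a 2, b 5 - a 4;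
        b 1 - a 1, 2 * b 3, b 4 - a 3, b 6 - a 5;
        b 2 - a 2, b 4 - a 3, 2 * b 7, b 8 - a 6;
        b 5 - a 4, b 6 - a 5, b 8 - a 6, 2 * b 9]
  | 7 =>
      !![2 * b 0, b 1 - a 1, b 3 - a 2, b 5 - a 4;
        b 1 - a 1, 2 * b 2, b 4 - a 3, b 6 - a 5;
        b 3 - a 2, b 4 - a 3, 2 * b 7, b 8 - a 6;
        b 5 - a 4, b 6 - a 5, b 8 - a 6, 2 * b 9]
  | 8 =>
      !![2 * b 0, b 1 - a 1, b 2 - a 2, b 4 - a 3;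
        b 1 - a 1, 2 * b 3, b 5 - a 4, b 7 - a 5;
        b 2 - a 2, b 5 - a 4, 2 * b 6, b 8 - a 6;
        b 4 - a 3, b 7 - a 5, b 8 - a 6, 2 * b 9]
  | 9 =>
      !![2 * b 0, b 1 - a 1, b 3 - a 2, b 4 - a 3;
        b 1 - a 1, 2 * b 2, b 5 - a 4, b 7 - a 5;
        b 3 - a 2, b 5 - a 4, 2 * b 6, b 8 - a 6;
        b 4 - a 3, b 7 - a 5, b 8 - a 6, 2 * b 9]
  | 10 =>
      !![2 * b 0, b 1 - a 1, b 2 - a 2, b 4 - a 3;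
        b 1 - a 1, 2 * b 3, b 5 - a 4, b 6 - a 5;
        b 2 - a 2, b 5 - a 4, 2 * b 7, b 8 - a 6;
        b 4 - a 3, b 6 - a 5, b 8 - a 6, 2 * b 9]
  | 11 =>
      !![2 * b 0, b 1 - a 1, b 3 - a 2, b 4 - a 3;
        b 1 - a 1, 2 * b 2, b 5 - a 4, b 6 - a 5;
        b 3 - a 2, b 5 - a 4, 2 * b 7, b 8 - a 6;
        b 4 - a 3, b 6 - a 5, b 8 - a 6, 2 * b 9]

/-- The twelve matrices of the eigenvalues `lam 1 ≥ … ≥ lam (4 * n)`: `LambdaMatrix n lam t` is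
`Λ_{t+1}` for `t = 0, …, 11`, with `a j = λ_j` and `b j = λ_{4n-j}`. -/
def LambdaMatrix (n : ℕ) (lam : ℕ → ℝ) (t : Fin 12) : Matrix (Fin 4) (Fin 4) ℝ :=
  lambdaPattern lam (fun j => lam (4 * n - j)) t

open Matrix Finset

/-! Let `ψ` have Schmidt coefficients `p 0 ≥ … ≥ p 3 ≥ 0`. The form of `X^Γ` at `ψ` is the trace of
`X` against the partial transpose of the projection onto `ψ`. That operator is diagonal in an
orthonormal family of sixteen vectors: eigenvalue `p i * p j` on the symmetric combinations (`i ≤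
j`), and `-p i * p j` on the antisymmetric ones (`i < j`). See `quadForm_partialTranspose_re` and
`IsOrthonormalFamily.symmFamily`.

As `X` runs through a unitary orbit, the form is smallest when the largest positive weights meet the
smallest eigenvalues and the most negative weights the largest ones; the bound is the weighted Ky
Fan inequality. The minimum is half the quadratic form at `p` of the pattern recording the order of
the products `p i * p j`, and twelve orders suffice (`exists_antitone_orders`).

Conversely, the pairing prescribed by any pattern is realised by some unitary, whatever the real
vector `p`, so each pattern must be positive semidefinite. -/

/-! ### Real inequalities -/

/-- Abel summation: weights that are nonnegative and decreasing preserve nonnegativity of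
partial sums. -/
theorem sum_mul_nonneg_of_prefix_sums_nonneg {K : ℕ} (μ x : Fin K → ℝ) (hμ : Antitone μ)
    (hμ0 : ∀ j, 0 ≤ μ j)
    (hx : ∀ k (hk : k ≤ K), 0 ≤ ∑ j : Fin k, x (Fin.castLE hk j)) :
    0 ≤ ∑ j, μ j * x j := by
  -- A stronger claim suited to induction: the weighted prefix sum dominates the plain one times the
  -- last weight, since lowering that weight only shrinks a nonnegative multiple.
  have key : ∀ k (hk : k + 1 ≤ K), μ ⟨k, hk⟩ * ∑ j : Fin (k + 1), x (Fin.castLE hk j) ≤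
      ∑ j : Fin (k + 1), μ (Fin.castLE hk j) * x (Fin.castLE hk j) := by
    intro k
    induction k with
    | zero => intro hk; simp [Fin.castLE]
    | succ k ih =>
      intro hk
      rw [Fin.sum_univ_castSucc, Fin.sum_univ_castSucc
        (fun j => μ (Fin.castLE hk j) * x (Fin.castLE hk j)), mul_add]
      refine add_le_add ?_ le_rfl
      refine le_trans ?_ (ih (by omega))
      exact mul_le_mul_of_nonneg_right (hμ (by simp)) (hx (k + 1) (by omega))
  cases K with
  | zero => simp
  | succ K => exact le_trans (mul_nonneg (hμ0 _) (hx _ le_rfl)) (key K le_rfl)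

/-- A weighting of an increasing sequence by `k` units of mass, at most one on each term, sums to
at least the first `k` terms. -/
theorem sum_initial_le_sum_mul {N k : ℕ} (hk : k ≤ N) (c d : Fin N → ℝ) (hd : Monotone d)
    (hc0 : ∀ l, 0 ≤ c l) (hc1 : ∀ l, c l ≤ 1) (hc : ∑ l, c l = k) :
    ∑ j : Fin k, d (Fin.castLE hk j) ≤ ∑ l, c l * d l := by
  cases k with
  | zero =>
    have : ∀ l, c l = 0 := by
      intro l
      exact (Finset.sum_eq_zero_iff_of_nonneg (fun i _ => hc0 i)).1 (by simpa using hc) l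
        (Finset.mem_univ _)
    simp [this]
  | succ k =>
    obtain ⟨m, rfl⟩ := Nat.exists_eq_add_of_le hk
    -- `T` is the last of the `k + 1` initial terms. Both sides carry mass `k + 1`, so subtracting
    -- `T` from `d` shifts them equally and leaves `d` nonpositive up to the cutoff and nonnegative
    -- beyond.
    set T := d ⟨k, by omega⟩ with hT
    have h1 : ∑ l, c l * d l = ∑ l, c l * (d l - T) + (k + 1 : ℕ) * T := by
      rw [← hc, Finset.sum_mul, ← Finset.sum_add_distrib]
      exact Finset.sum_congr rfl fun _ _ => by ring
    have h2 : ∑ j : Fin (k + 1), d (Fin.castLE hk j) =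
        ∑ j : Fin (k + 1), (d (Fin.castLE hk j) - T) + (k + 1 : ℕ) * T := by
      simp
    rw [h1, h2]
    refine add_le_add ?_ le_rfl
    rw [Fin.sum_univ_add (fun l => c l * (d l - T)),
      ← add_zero (∑ j : Fin (k + 1), (d (Fin.castLE hk j) - T))]
    refine add_le_add (Finset.sum_le_sum fun j _ => ?_) (Finset.sum_nonneg fun j _ => ?_)
    · have h3 : d (Fin.castAdd m j) ≤ T := hd (by rw [Fin.le_def]; simp; omega)
      have h4 := hc1 (Fin.castAdd m j)
      have h5 : Fin.castLE hk j = Fin.castAdd m j := rfl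
      rw [h5]
      nlinarith
    · have h3 : T ≤ d (Fin.natAdd (k + 1) j) := hd (by rw [Fin.le_def]; simp; omega)
      exact mul_nonneg (hc0 _) (by linarith)

/-- Abel summation reduces to equal weights on the first `k` rows. Their column sums are a mass `k`
with at most one unit per column. -/
theorem sum_mul_initial_le_of_substochastic {N K : ℕ} (hK : K ≤ N) (μ : Fin K → ℝ)
    (hμ : Antitone μ) (hμ0 : ∀ j, 0 ≤ μ j) (D : Fin K → Fin N → ℝ) (hD0 : ∀ j l, 0 ≤ D j l)
    (hrow : ∀ j, ∑ l, D j l = 1) (hcol : ∀ l, ∑ j, D j l ≤ 1) (d : Fin N → ℝ)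
    (hd : Monotone d) :
    ∑ j, μ j * d (Fin.castLE hK j) ≤ ∑ j, μ j * ∑ l, D j l * d l := by
  have := sum_mul_nonneg_of_prefix_sums_nonneg μ
    (fun j => ∑ l, D j l * d l - d (Fin.castLE hK j)) hμ hμ0 ?_
  · simp only [mul_sub, Finset.sum_sub_distrib] at this
    linarith
  · intro k hk
    rw [Finset.sum_sub_distrib, Finset.sum_comm]
    simp only [← Finset.sum_mul]
    have := sum_initial_le_sum_mul (hk.trans hK)
      (fun l => ∑ j : Fin k, D (Fin.castLE hk j) l) d hd
      (fun l => Finset.sum_nonneg fun _ _ => hD0 _ _) (fun l => ?_) ?_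
    · simpa [sub_nonneg] using this
    · refine le_trans ?_ (hcol l)
      refine (Finset.sum_map univ (Fin.castLEEmb hk) (fun j => D j l)).symm.trans_le ?_
      exact Finset.sum_le_sum_of_subset_of_nonneg (Finset.subset_univ _) fun _ _ _ => hD0 _ _
    · rw [Finset.sum_comm]
      simp [hrow]

/-! ### Orthonormal families of coordinate vectors -/

/-- Orthonormality of a family of coordinate vectors. -/
def IsOrthonormalFamily {κ ι : Type*} [DecidableEq κ] [Fintype ι] (w : κ → ι → ℂ) : Prop :=
  ∀ i j, star (w i) ⬝ᵥ w j = if i = j then 1 else 0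

theorem IsOrthonormalFamily.comp {κ κ' ι : Type*} [DecidableEq κ] [DecidableEq κ'] [Fintype ι]
    {w : κ → ι → ℂ} (hw : IsOrthonormalFamily w) {g : κ' → κ} (hg : Function.Injective g) :
    IsOrthonormalFamily (w ∘ g) := by
  intro i j
  simp [hw (g i) (g j), hg.eq_iff]

theorem IsOrthonormalFamily.orthonormal {κ ι : Type*} [DecidableEq κ] [Fintype ι]
    {w : κ → ι → ℂ} (hw : IsOrthonormalFamily w) :
    Orthonormal ℂ fun k => (WithLp.toLp 2 (w k) : EuclideanSpace ℂ ι) := by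
  rw [orthonormal_iff_ite]
  intro i j
  rw [← hw i j, EuclideanSpace.inner_eq_star_dotProduct, dotProduct_comm]

/-- An orthonormal family extends to the columns of a unitary matrix. -/
theorem IsOrthonormalFamily.exists_unitary {κ ι : Type*} [DecidableEq κ] [Fintype ι]
    [DecidableEq ι] {w : κ → ι → ℂ} (hw : IsOrthonormalFamily w) {g : κ → ι}
    (hg : Function.Injective g) :
    ∃ W ∈ unitaryGroup ι ℂ, ∀ k i, W i (g k) = w k i := by
  -- The default value `0` off the range of `g` is harmless: orthonormality is needed only on that
  -- range.
  set v : ι → EuclideanSpace ℂ ι := Function.extend g (fun k => WithLp.toLp 2 (w k)) 0 with hv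
  have hvg : ∀ k, v (g k) = WithLp.toLp 2 (w k) := fun k => hg.extend_apply _ _ _
  have ho : Orthonormal ℂ ((Set.range g).domRestrict v) := by
    rw [orthonormal_iff_ite]
    rintro ⟨_, i, rfl⟩ ⟨_, j, rfl⟩
    have := orthonormal_iff_ite.1 hw.orthonormal i j
    have hij : ((⟨g i, Set.mem_range_self i⟩ : Set.range g) = ⟨g j, Set.mem_range_self j⟩) ↔ i = j := by
      exact ⟨fun h => hg (congrArg Subtype.val h), fun h => by subst h; rfl⟩
    by_cases h : i = j
    · rw [if_pos (hij.2 h)]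
      simpa [Set.domRestrict, hvg, h] using this
    · rw [if_neg (mt hij.1 h)]
      simpa [Set.domRestrict, hvg, h] using this
  obtain ⟨b, hb⟩ := ho.exists_orthonormalBasis_extension_of_card_eq (by simp)
  refine ⟨(EuclideanSpace.basisFun ι ℂ).toBasis.toMatrix b.toBasis,
    (EuclideanSpace.basisFun ι ℂ).toMatrix_orthonormalBasis_mem_unitary b, fun k i => ?_⟩
  have := hb (g k) ⟨k, rfl⟩
  simp [Module.Basis.toMatrix_apply, this, hvg]

/-- Bessel's inequality at a coordinate vector; it gives the column bound for the array of squared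
moduli. -/
theorem IsOrthonormalFamily.sum_norm_sq_le_one {κ ι : Type*} [DecidableEq κ] [Fintype κ]
    [Fintype ι] [DecidableEq ι] {w : κ → ι → ℂ} (hw : IsOrthonormalFamily w) (i : ι) :
    ∑ k, ‖w k i‖ ^ 2 ≤ 1 := by
  have := hw.orthonormal.sum_inner_products_le (EuclideanSpace.single i (1 : ℂ)) (s := univ)
  simpa [EuclideanSpace.inner_single_right] using this

theorem IsOrthonormalFamily.sum_norm_sq_eq_one {κ ι : Type*} [DecidableEq κ]
    [Fintype ι] {w : κ → ι → ℂ} (hw : IsOrthonormalFamily w) (k : κ) :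
    ∑ i, ‖w k i‖ ^ 2 = 1 := by
  have := hw k k
  simp only [dotProduct, Pi.star_apply, RCLike.star_def, Complex.conj_mul', if_true] at this
  exact_mod_cast this

theorem IsOrthonormalFamily.mulVec {κ ι : Type*} [DecidableEq κ] [Fintype ι] [DecidableEq ι]
    {w : κ → ι → ℂ} (hw : IsOrthonormalFamily w) {V : Matrix ι ι ℂ} (hV : V ∈ unitaryGroup ι ℂ) :
    IsOrthonormalFamily fun k => V *ᵥ w k := by
  intro i j
  rw [star_mulVec, dotProduct_mulVec, vecMul_vecMul, ← star_eq_conjTranspose,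
    mem_unitaryGroup_iff'.1 hV, vecMul_one, hw]

/-! ### Spectral decomposition and Ky Fan inequalities -/

/-- The quadratic form of a matrix. -/
def quadForm {ι : Type*} [Fintype ι] (X : Matrix ι ι ℂ) (w : ι → ℂ) : ℂ := star w ⬝ᵥ (X *ᵥ w)

theorem quadForm_conj_diagonal {ι : Type*} [Fintype ι] [DecidableEq ι] (W : Matrix ι ι ℂ)
    (d : ι → ℝ) (w : ι → ℂ) :
    quadForm (W * diagonal (fun i => (d i : ℂ)) * Wᴴ) w =
      ((∑ l, ‖(Wᴴ *ᵥ w) l‖ ^ 2 * d l : ℝ) : ℂ) := by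
  have : star w ᵥ* W = star (Wᴴ *ᵥ w) := by rw [star_mulVec, conjTranspose_conjTranspose]
  rw [quadForm, ← mulVec_mulVec, ← mulVec_mulVec, dotProduct_mulVec, this]
  simp only [dotProduct, mulVec_diagonal, Pi.star_apply, RCLike.star_def]
  push_cast
  refine Finset.sum_congr rfl fun l _ => ?_
  rw [← Complex.conj_mul']
  ring

/-- Weighted Ky Fan inequality: lower bound for quadratic forms on an orthonormal family. -/
theorem sum_mul_initial_le_quadForm {ι : Type*} [Fintype ι] [DecidableEq ι] {N K : ℕ}
    (hK : K ≤ N) (g : ι ≃ Fin N) {d : Fin N → ℝ} (hd : Monotone d) {W : Matrix ι ι ℂ}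
    (hW : W ∈ unitaryGroup ι ℂ) {w : Fin K → ι → ℂ} (hw : IsOrthonormalFamily w)
    {μ : Fin K → ℝ} (hμ : Antitone μ) (hμ0 : ∀ j, 0 ≤ μ j) :
    ∑ j, μ j * d (Fin.castLE hK j) ≤
      ∑ j, μ j * (quadForm (W * diagonal (fun i => (d (g i) : ℂ)) * Wᴴ) (w j)).re := by
  have hy : IsOrthonormalFamily fun k => Wᴴ *ᵥ w k := hw.mulVec (Unitary.star_mem hW)
  have := sum_mul_initial_le_of_substochastic hK μ hμ hμ0
    (fun j l => ‖(Wᴴ *ᵥ w j) (g.symm l)‖ ^ 2) (fun _ _ => by positivity)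
    (fun j => by
      rw [Equiv.sum_comp g.symm (fun i => ‖(Wᴴ *ᵥ w j) i‖ ^ 2)]
      exact hy.sum_norm_sq_eq_one j)
    (fun l => hy.sum_norm_sq_le_one _) d hd
  refine this.trans_eq (Finset.sum_congr rfl fun j _ => ?_)
  rw [quadForm_conj_diagonal W (fun i => d (g i)), Complex.ofReal_re, ← Equiv.sum_comp g]
  simp

/-- Weighted Ky Fan inequality: upper bound for quadratic forms on an orthonormal family. -/
theorem quadForm_le_sum_mul_initial {ι : Type*} [Fintype ι] [DecidableEq ι] {N K : ℕ}
    (hK : K ≤ N) (g : ι ≃ Fin N) {d : Fin N → ℝ} (hd : Antitone d) {W : Matrix ι ι ℂ}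
    (hW : W ∈ unitaryGroup ι ℂ) {w : Fin K → ι → ℂ} (hw : IsOrthonormalFamily w)
    {μ : Fin K → ℝ} (hμ : Antitone μ) (hμ0 : ∀ j, 0 ≤ μ j) :
    ∑ j, μ j * (quadForm (W * diagonal (fun i => (d (g i) : ℂ)) * Wᴴ) (w j)).re ≤
      ∑ j, μ j * d (Fin.castLE hK j) := by
  have := sum_mul_initial_le_quadForm hK g (d := -d) hd.neg hW hw hμ hμ0
  rw [← neg_le_neg_iff]
  simp only [quadForm_conj_diagonal W (fun i => d (g i)),
    quadForm_conj_diagonal W (fun i => (-d) (g i))] at this ⊢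
  simpa using this

/-- Equal multiplicities make corresponding fibres equinumerous, and bijections of the fibres glue.
-/
theorem exists_equiv_of_map_univ_eq {α β γ : Type*} [Fintype α] [Fintype β] {f : α → γ}
    {h : β → γ} (H : Multiset.map f univ.val = Multiset.map h univ.val) :
    ∃ g : α ≃ β, ∀ a, h (g a) = f a := by
  classical
  have hc : ∀ c, Nonempty ({a // f a = c} ≃ {b // h b = c}) := by
    intro c
    rw [← Fintype.card_eq, Fintype.card_subtype, Fintype.card_subtype]
    have := congrArg (Multiset.count c) H
    rw [Multiset.count_map, Multiset.count_map] at this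
    simpa [Finset.card, eq_comm] using this
  exact ⟨Equiv.ofFiberEquiv fun c => (hc c).some, fun a => Equiv.ofFiberEquiv_map _ a⟩

/-- Diagonalisation of a Hermitian matrix with a prescribed enumeration of its spectrum. -/
theorem IsDecreasingSpectrum.exists_unitary_diagonal {ι : Type*} [Fintype ι] [DecidableEq ι]
    {A : Matrix ι ι ℂ} (hA : A.IsHermitian) {N : ℕ} {lam : ℕ → ℝ}
    (h : IsDecreasingSpectrum A N lam) :
    ∃ g : ι ≃ Fin N, ∃ V ∈ unitaryGroup ι ℂ,
      A = V * diagonal (fun i => (lam (g i + 1) : ℂ)) * Vᴴ := by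
  have hr : Multiset.map hA.eigenvalues univ.val =
      Multiset.map (fun l : Fin N => lam (l + 1)) univ.val := by
    have h1 := hA.roots_charpoly_eq_eigenvalues
    have h2 : A.charpoly = ∏ l : Fin N, (Polynomial.X - Polynomial.C (lam (l + 1) : ℂ)) := by
      rw [h.2, Fin.prod_univ_eq_prod_range
        (fun k => Polynomial.X - Polynomial.C (lam (k + 1) : ℂ)), Finset.range_eq_Ico,
        Finset.prod_Ico_add' (fun k => Polynomial.X - Polynomial.C (lam k : ℂ))]
      rfl
    rw [h2, Polynomial.roots_prod _ _
      (by simp [Finset.prod_ne_zero_iff, Polynomial.X_sub_C_ne_zero])] at h1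
    have h3 := congrArg (Multiset.map Complex.re) h1
    simpa [Multiset.map_map, Function.comp_def, eq_comm] using h3
  obtain ⟨g, hg⟩ := exists_equiv_of_map_univ_eq hr
  refine ⟨g, hA.eigenvectorUnitary, hA.eigenvectorUnitary.2, ?_⟩
  conv_lhs => rw [hA.spectral_theorem, Unitary.conjStarAlgAut_apply]
  simp only [hg]
  rfl

/-! ### Schmidt decomposition -/

/-- Schmidt decomposition with nonnegative decreasing coefficients. -/
theorem exists_schmidt_decomposition {m n : ℕ} (hmn : m ≤ n) (ψ : Matrix (Fin m) (Fin n) ℂ) :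
    ∃ (p : Fin m → ℝ) (e : Fin m → Fin m → ℂ) (f : Fin m → Fin n → ℂ), Antitone p ∧
      (∀ i, 0 ≤ p i) ∧ IsOrthonormalFamily e ∧ IsOrthonormalFamily f ∧
      ∀ a b, ψ a b = ∑ i, (p i : ℂ) * e i a * f i b := by
  have hpsd : (ψ * ψᴴ).PosSemidef := posSemidef_self_mul_conjTranspose ψ
  have hA : (ψ * ψᴴ).IsHermitian := hpsd.1
  set E : Matrix (Fin m) (Fin m) ℂ := hA.eigenvectorUnitary.1 with hE
  have hEu : E ∈ unitaryGroup (Fin m) ℂ := hA.eigenvectorUnitary.2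
  set ν := hA.eigenvalues with hν
  have hν0 : ∀ i, 0 ≤ ν i := hpsd.eigenvalues_nonneg
  -- The rows of `G` are orthogonal with squared norms `ν i`; normalised, they become the second
  -- Schmidt vectors.
  set G : Matrix (Fin m) (Fin n) ℂ := Eᴴ * ψ with hG
  have hψ : ψ = E * G := by
    rw [hG, ← Matrix.mul_assoc, ← star_eq_conjTranspose, mem_unitaryGroup_iff.1 hEu,
      Matrix.one_mul]
  have hGG : G * Gᴴ = diagonal (fun i => (ν i : ℂ)) := by
    have h1 : ψ * ψᴴ = E * diagonal (fun i => (ν i : ℂ)) * star E := by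
      conv_lhs => rw [hA.spectral_theorem, Unitary.conjStarAlgAut_apply]
      rfl
    rw [hG, conjTranspose_mul, conjTranspose_conjTranspose, Matrix.mul_assoc,
      ← Matrix.mul_assoc ψ, h1, ← star_eq_conjTranspose]
    have h2 := mem_unitaryGroup_iff'.1 hEu
    simp only [Matrix.mul_assoc, h2, Matrix.mul_one]
    rw [← Matrix.mul_assoc, h2, Matrix.one_mul]
  have hGo : ∀ i j, star (G i) ⬝ᵥ G j = if i = j then (ν i : ℂ) else 0 := by
    intro i j
    have := congrFun (congrFun hGG j) i
    rw [mul_apply, diagonal_apply] at this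
    simp only [conjTranspose_apply] at this
    rw [dotProduct_comm]
    simp only [dotProduct, Pi.star_apply, this, eq_comm (a := i)]
    split_ifs with h <;> simp [h]
  have hon : IsOrthonormalFamily
      (fun i : {i : Fin m // ν i ≠ 0} => ((√(ν i) : ℝ) : ℂ)⁻¹ • G i) := by
    rintro ⟨i, hi⟩ ⟨j, hj⟩
    simp only [star_smul, smul_dotProduct, dotProduct_smul, hGo, Subtype.mk_eq_mk]
    split_ifs with h
    · subst h
      have h3 : ((√(ν i) : ℝ) : ℂ) * ((√(ν i) : ℝ) : ℂ) = ν i := by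
        exact_mod_cast Real.mul_self_sqrt (hν0 i)
      have h4 : ((√(ν i) : ℝ) : ℂ) ≠ 0 := by
        intro h0
        rw [h0] at h3
        simp at h3
        exact hi (by exact_mod_cast h3.symm)
      simp only [smul_eq_mul, ← h3, star_inv₀, RCLike.star_def, Complex.conj_ofReal]
      field_simp
    · simp
  -- Rows with `ν i = 0` cannot be normalised; the unitary extension supplies their Schmidt vectors.
  obtain ⟨F, hF, hFG⟩ := hon.exists_unitary (g := fun i => Fin.castLE hmn i.1)
    (fun a b h => Subtype.ext (Fin.castLE_injective hmn h))
  set f : Fin m → Fin n → ℂ := fun i b => F b (Fin.castLE hmn i) with hf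
  have hfo : IsOrthonormalFamily f := by
    intro i j
    have := congrFun (congrFun (mem_unitaryGroup_iff'.1 hF) (Fin.castLE hmn i)) (Fin.castLE hmn j)
    rw [mul_apply, one_apply] at this
    simpa [dotProduct, hf, star_apply] using this
  have hGf : ∀ i b, G i b = (√(ν i) : ℝ) * f i b := by
    intro i b
    by_cases hi : ν i = 0
    · have h1 := hGo i i
      rw [if_pos rfl, hi, Complex.ofReal_zero, dotProduct_star_self_eq_zero] at h1
      simp [h1, hi]
    · have h4 : ((√(ν i) : ℝ) : ℂ) ≠ 0 := by
        rw [Complex.ofReal_ne_zero]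
        exact (Real.sqrt_pos.2 (lt_of_le_of_ne (hν0 i) (Ne.symm hi))).ne'
      have := hFG ⟨i, hi⟩ b
      simp only [hf, this, Pi.smul_apply, smul_eq_mul]
      field_simp
  have heo : IsOrthonormalFamily (fun i a => E a i) := by
    intro i j
    have := congrFun (congrFun (mem_unitaryGroup_iff'.1 hEu) i) j
    rw [mul_apply, one_apply] at this
    simpa [dotProduct, star_apply] using this
  set σ := Tuple.sort (fun i => -√(ν i)) with hσ
  have hmono : Monotone ((fun i => -√(ν i)) ∘ σ) := Tuple.monotone_sort _
  refine ⟨fun i => √(ν (σ i)), fun i a => E a (σ i), fun i => f (σ i), fun i j hij => ?_,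
    fun i => Real.sqrt_nonneg _, heo.comp σ.injective, hfo.comp σ.injective, fun a b => ?_⟩
  · simpa using hmono hij
  · rw [Equiv.sum_comp σ (fun i => ((√(ν i) : ℝ) : ℂ) * E a i * f i b)]
    conv_lhs => rw [hψ, mul_apply]
    refine Finset.sum_congr rfl fun i _ => ?_
    rw [hGf]
    ring

/-! ### The quadratic form of a partial transpose -/

/-- The product vector `u ⊗ v̄`. -/
def conjTensor {m n : ℕ} (u : Fin m → ℂ) (v : Fin n → ℂ) : Fin m × Fin n → ℂ :=
  fun x => u x.1 * star (v x.2)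

theorem star_conjTensor_dotProduct {m n : ℕ} (u u' : Fin m → ℂ) (v v' : Fin n → ℂ) :
    star (conjTensor u v) ⬝ᵥ conjTensor u' v' = (star u ⬝ᵥ u') * (star v' ⬝ᵥ v) := by
  simp only [dotProduct, conjTensor, Fintype.sum_prod_type, Finset.sum_mul_sum, Pi.star_apply,
    star_mul', star_star]
  exact Finset.sum_congr rfl fun _ _ => Finset.sum_congr rfl fun _ _ => by ring

/-- The symmetric (`i < j`), antisymmetric (`j < i`) and diagonal combinations of the product
vectors `e i ⊗ f̄ j`. -/
noncomputable def symmFamily {k m n : ℕ} (e : Fin k → Fin m → ℂ) (f : Fin k → Fin n → ℂ)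
    (x : Fin k × Fin k) : Fin m × Fin n → ℂ :=
  if x.1 = x.2 then conjTensor (e x.1) (f x.2)
  else if x.1 < x.2 then
    ((√2)⁻¹ : ℂ) • (conjTensor (e x.1) (f x.2) + conjTensor (e x.2) (f x.1))
  else ((√2)⁻¹ : ℂ) • (conjTensor (e x.2) (f x.1) - conjTensor (e x.1) (f x.2))

theorem inv_sqrt_two_mul_self : ((√2)⁻¹ : ℂ) * ((√2)⁻¹ : ℂ) = 1 / 2 := by
  have : ((√2 : ℝ) : ℂ) * (√2 : ℝ) = 2 := by
    exact_mod_cast Real.mul_self_sqrt (by norm_num : (0 : ℝ) ≤ 2)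
  rw [← mul_inv, this, one_div]

/-- The products are orthonormal, and each pair `i ≠ j` is rotated within its own plane. -/
theorem IsOrthonormalFamily.symmFamily {k m n : ℕ} {e : Fin k → Fin m → ℂ}
    {f : Fin k → Fin n → ℂ} (he : IsOrthonormalFamily e) (hf : IsOrthonormalFamily f) :
    IsOrthonormalFamily (symmFamily e f) := by
  have hT : ∀ i j i' j', star (conjTensor (e i) (f j)) ⬝ᵥ conjTensor (e i') (f j') =
      if i = i' ∧ j = j' then 1 else 0 := by
    intro i j i' j'
    rw [star_conjTensor_dotProduct, he, hf]
    by_cases h : i = i' <;> by_cases h' : j = j' <;> simp [h, h', eq_comm]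
  have hs : star ((√2)⁻¹ : ℂ) = ((√2)⁻¹ : ℂ) := by simp
  have h2 := inv_sqrt_two_mul_self
  rintro ⟨i, j⟩ ⟨i', j'⟩
  simp only [_root_.symmFamily, Prod.mk.injEq]
  rcases lt_trichotomy i j with h | rfl | h <;> rcases lt_trichotomy i' j' with h' | rfl | h' <;>
    simp only [*, LT.lt.ne, LT.lt.ne', LT.lt.not_gt, if_true, if_false,
      lt_irrefl, star_smul, star_add, star_sub, smul_dotProduct, dotProduct_smul, add_dotProduct,
      dotProduct_add, sub_dotProduct, dotProduct_sub, smul_eq_mul] <;>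
    split_ifs <;> first | omega | (norm_num; done) | linear_combination 2 * h2

/-- Pure multilinear expansion: the transpose exchanges the second indices of the two copies of `ψ`,
so `e i` meets the conjugate of `f j`. Orthonormality plays no role. -/
theorem quadForm_partialTranspose {m n k : ℕ} (X : Matrix (Fin m × Fin n) (Fin m × Fin n) ℂ)
    (p : Fin k → ℝ) (e : Fin k → Fin m → ℂ) (f : Fin k → Fin n → ℂ)
    (ψ : Fin m × Fin n → ℂ) (hψ : ∀ x, ψ x = ∑ i, (p i : ℂ) * e i x.1 * f i x.2) :
    quadForm (partialTranspose X) ψ = ∑ i, ∑ j, (p i * p j : ℂ) *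
      (star (conjTensor (e i) (f j)) ⬝ᵥ (X *ᵥ conjTensor (e j) (f i))) := by
  have h1 : quadForm (partialTranspose X) ψ = ∑ x, ∑ y,
      star (ψ (x.1, y.2)) * X x y * ψ (y.1, x.2) := by
    simp only [quadForm, dotProduct, mulVec, Fintype.sum_prod_type, Finset.mul_sum]
    refine Finset.sum_congr rfl fun a _ => ?_
    -- Exchanging the two second-factor summation indices moves the transpose from `X` onto `ψ`.
    have hrev : ∀ F : Fin n → Fin m → Fin n → ℂ,
        ∑ b, ∑ c, ∑ d, F b c d = ∑ d, ∑ c, ∑ b, F b c d := by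
      intro F
      calc _ = ∑ b, ∑ d, ∑ c, F b c d := Finset.sum_congr rfl fun _ _ => Finset.sum_comm
        _ = ∑ d, ∑ b, ∑ c, F b c d := Finset.sum_comm
        _ = _ := Finset.sum_congr rfl fun _ _ => Finset.sum_comm
    rw [hrev]
    refine Finset.sum_congr rfl fun d _ => Finset.sum_congr rfl fun c _ =>
      Finset.sum_congr rfl fun b _ => (mul_assoc _ _ _).symm
  have h2 : ∀ i j, (star (conjTensor (e i) (f j)) ⬝ᵥ (X *ᵥ conjTensor (e j) (f i))) =
      ∑ x, ∑ y, star (e i x.1) * f j x.2 * X x y * (e j y.1 * star (f i y.2)) := by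
    intro i j
    simp only [dotProduct, mulVec, Finset.mul_sum, conjTensor,
      Pi.star_apply, star_mul', star_star, ← mul_assoc]
  have h3 : ∀ x y, star (ψ (x.1, y.2)) * X x y * ψ (y.1, x.2) =
      ∑ i, ∑ j, (p i * p j : ℂ) *
        (star (e i x.1) * f j x.2 * X x y * (e j y.1 * star (f i y.2))) := by
    intro x y
    have hp : ∀ i, star (p i : ℂ) = p i := fun i => by simp
    simp only [hψ, star_sum, Finset.sum_mul, Finset.mul_sum, star_mul', hp]
    rw [Finset.sum_comm]
    refine Finset.sum_congr rfl fun i _ => Finset.sum_congr rfl fun j _ => ?_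
    ring
  simp only [h1, h2, h3, Finset.mul_sum]
  calc _ = _ := Finset.sum_congr rfl fun _ _ => Finset.sum_comm
    _ = _ := Finset.sum_comm
    _ = _ := Finset.sum_congr rfl fun i _ =>
      (Finset.sum_congr rfl fun _ _ => Finset.sum_comm).trans Finset.sum_comm

/-- Polarisation: the diagonal terms cancel, so the swapped matrix elements become a difference of
quadratic forms. -/
theorem quadForm_half_sub {ι : Type*} [Fintype ι] (X : Matrix ι ι ℂ) (u v : ι → ℂ) :
    quadForm X (((√2)⁻¹ : ℂ) • (u + v)) - quadForm X (((√2)⁻¹ : ℂ) • (u - v)) =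
      star u ⬝ᵥ (X *ᵥ v) + star v ⬝ᵥ (X *ᵥ u) := by
  have hs : star ((√2)⁻¹ : ℂ) = ((√2)⁻¹ : ℂ) := by simp
  simp only [quadForm, star_smul, star_add, star_sub, smul_dotProduct, dotProduct_smul,
    mulVec_smul, mulVec_add, mulVec_sub, add_dotProduct,
    dotProduct_add, sub_dotProduct, dotProduct_sub, smul_eq_mul, hs]
  linear_combination (2 * (star u ⬝ᵥ (X *ᵥ v) + star v ⬝ᵥ (X *ᵥ u))) * inv_sqrt_two_mul_self

/-- The quadratic form of `X^Γ` at a vector with Schmidt coefficients `p`. -/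
theorem quadForm_partialTranspose_eq_sum_symmFamily {m n : ℕ}
    (X : Matrix (Fin m × Fin n) (Fin m × Fin n) ℂ)
    (p : Fin 4 → ℝ) (e : Fin 4 → Fin m → ℂ) (f : Fin 4 → Fin n → ℂ)
    (ψ : Fin m × Fin n → ℂ) (hψ : ∀ x, ψ x = ∑ i, (p i : ℂ) * e i x.1 * f i x.2) :
    quadForm (partialTranspose X) ψ = ∑ x : Fin 4 × Fin 4,
      (if x.1 ≤ x.2 then 1 else -1) * (p x.1 * p x.2 : ℂ) * quadForm X (symmFamily e f x) := by
  rw [quadForm_partialTranspose X p e f ψ hψ, Fintype.sum_prod_type]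
  have key : ∀ i j, i < j → quadForm X (symmFamily e f (i, j)) -
      quadForm X (symmFamily e f (j, i)) =
      (star (conjTensor (e i) (f j)) ⬝ᵥ (X *ᵥ conjTensor (e j) (f i))) +
      (star (conjTensor (e j) (f i)) ⬝ᵥ (X *ᵥ conjTensor (e i) (f j))) := by
    intro i j h
    rw [← quadForm_half_sub]
    simp [symmFamily, h.ne, h.ne', h, h.not_gt]
  have diag : ∀ i, quadForm X (symmFamily e f (i, i)) =
      (star (conjTensor (e i) (f i)) ⬝ᵥ (X *ᵥ conjTensor (e i) (f i))) := by
    intro i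
    simp [symmFamily, quadForm]
  simp only [Fin.sum_univ_four, ← diag]
  have h01 := key 0 1 (by decide)
  have h02 := key 0 2 (by decide)
  have h03 := key 0 3 (by decide)
  have h12 := key 1 2 (by decide)
  have h13 := key 1 3 (by decide)
  have h23 := key 2 3 (by decide)
  simp only [show ¬ ((1 : Fin 4) ≤ 0) by decide, show ¬ ((2 : Fin 4) ≤ 0) by decide,
    show ¬ ((3 : Fin 4) ≤ 0) by decide, show ¬ ((2 : Fin 4) ≤ 1) by decide,
    show ¬ ((3 : Fin 4) ≤ 1) by decide, show ¬ ((3 : Fin 4) ≤ 2) by decide,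
    show ((0 : Fin 4) ≤ 1) by decide, show ((0 : Fin 4) ≤ 2) by decide,
    show ((0 : Fin 4) ≤ 3) by decide, show ((1 : Fin 4) ≤ 2) by decide,
    show ((1 : Fin 4) ≤ 3) by decide, show ((2 : Fin 4) ≤ 3) by decide, le_refl, if_true, if_false]
  linear_combination (-(p 0 * p 1 : ℂ)) * h01 - (p 0 * p 2 : ℂ) * h02 - (p 0 * p 3 : ℂ) * h03 -
    (p 1 * p 2 : ℂ) * h12 - (p 1 * p 3 : ℂ) * h13 - (p 2 * p 3 : ℂ) * h23

/-! ### The twelve orderings of the products of Schmidt coefficients -/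

/-- `posOrder t k` is the pair `(i, j)`, `i ≤ j`, for which `b k` stands in the entry `(i, j)` of
the pattern `t`. -/
def posOrder : Fin 12 → Fin 10 → Fin 4 × Fin 4 :=
  ![![(0, 0), (0, 1), (0, 2), (0, 3), (1, 1), (1, 2), (1, 3), (2, 2), (2, 3), (3, 3)],
    ![(0, 0), (0, 1), (0, 2), (0, 3), (1, 1), (1, 2), (2, 2), (1, 3), (2, 3), (3, 3)],
    ![(0, 0), (0, 1), (0, 2), (1, 1), (1, 2), (2, 2), (0, 3), (1, 3), (2, 3), (3, 3)],
    ![(0, 0), (0, 1), (1, 1), (0, 2), (1, 2), (2, 2), (0, 3), (1, 3), (2, 3), (3, 3)],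
    ![(0, 0), (0, 1), (0, 2), (1, 1), (1, 2), (0, 3), (2, 2), (1, 3), (2, 3), (3, 3)],
    ![(0, 0), (0, 1), (1, 1), (0, 2), (1, 2), (0, 3), (2, 2), (1, 3), (2, 3), (3, 3)],
    ![(0, 0), (0, 1), (0, 2), (1, 1), (1, 2), (0, 3), (1, 3), (2, 2), (2, 3), (3, 3)],
    ![(0, 0), (0, 1), (1, 1), (0, 2), (1, 2), (0, 3), (1, 3), (2, 2), (2, 3), (3, 3)],
    ![(0, 0), (0, 1), (0, 2), (1, 1), (0, 3), (1, 2), (2, 2), (1, 3), (2, 3), (3, 3)],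
    ![(0, 0), (0, 1), (1, 1), (0, 2), (0, 3), (1, 2), (2, 2), (1, 3), (2, 3), (3, 3)],
    ![(0, 0), (0, 1), (0, 2), (1, 1), (0, 3), (1, 2), (1, 3), (2, 2), (2, 3), (3, 3)],
    ![(0, 0), (0, 1), (1, 1), (0, 2), (0, 3), (1, 2), (1, 3), (2, 2), (2, 3), (3, 3)]]

/-- `negOrder t k` is the pair `(i, j)`, `j < i`, for which `a (k + 1)` stands in the entry
`(i, j)` of the pattern `t`. -/
def negOrder (t : Fin 12) : Fin 6 → Fin 4 × Fin 4 :=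
  if t ∈ ({2, 3, 4, 5, 6, 7} : Finset (Fin 12)) then
    ![(1, 0), (2, 0), (2, 1), (3, 0), (3, 1), (3, 2)]
  else ![(1, 0), (2, 0), (3, 0), (2, 1), (3, 1), (3, 2)]

/-- Each pattern lists all sixteen pairs once, so sums may be reindexed along it and its vectors
stay orthonormal. -/
theorem sumElim_negOrder_posOrder_injective (t : Fin 12) :
    Function.Injective (Sum.elim (negOrder t) (posOrder t)) := by
  revert t
  unfold Function.Injective
  decide +kernel

theorem le_posOrder (t : Fin 12) (k : Fin 10) : (posOrder t k).1 ≤ (posOrder t k).2 := by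
  revert t k
  decide +kernel

theorem negOrder_lt (t : Fin 12) (k : Fin 6) : (negOrder t k).2 < (negOrder t k).1 := by
  revert t k
  decide +kernel

theorem sum_pairs_eq_sum_orders (t : Fin 12) (F : Fin 4 × Fin 4 → ℝ) :
    ∑ x, F x = ∑ k, F (posOrder t k) + ∑ k, F (negOrder t k) := by
  have hb : Function.Bijective (Sum.elim (negOrder t) (posOrder t)) :=
    (Fintype.bijective_iff_injective_and_card _).2
      ⟨sumElim_negOrder_posOrder_injective t, by simp⟩
  rw [← (Equiv.ofBijective _ hb).sum_comp, Fintype.sum_sum_type, add_comm]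
  rfl

/-- The factor `2` arises because off-diagonal entries occur twice and diagonal entries carry it
explicitly. -/
theorem dotProduct_lambdaPattern (a b : ℕ → ℝ) (t : Fin 12) (p : Fin 4 → ℝ) :
    p ⬝ᵥ (lambdaPattern a b t *ᵥ p) = 2 *
      (∑ k, p (posOrder t k).1 * p (posOrder t k).2 * b k -
        ∑ k, p (negOrder t k).1 * p (negOrder t k).2 * a (k + 1)) := by
  fin_cases t <;>
  · simp [lambdaPattern, dotProduct, Matrix.mulVec, Fin.sum_univ_succ, posOrder, negOrder,
      Fin.succ]
    ring

theorem isHermitian_lambdaPattern (a b : ℕ → ℝ) (t : Fin 12) :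
    (lambdaPattern a b t).IsHermitian := by
  ext i j
  fin_cases t <;> fin_cases i <;> fin_cases j <;> rfl

/-- Monotonicity leaves only `p 0 * p 3` undecided within the chain `p 1 * p 1 ≥ p 1 * p 2 ≥ p 2 * p
2`, together with `p 1 * p 1` against `p 0 * p 2` and `p 2 * p 2` against `p 1 * p 3`. The first
slot for `p 0 * p 3` forces the former comparison, the last slot the latter, giving 2 + 4 + 4 + 2
cases. The negative order depends only on `p 1 * p 2` against `p 0 * p 3`. -/
theorem exists_antitone_orders {p : Fin 4 → ℝ} (hp : Antitone p) (hp0 : ∀ i, 0 ≤ p i) :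
    ∃ t, Antitone (fun k => p (posOrder t k).1 * p (posOrder t k).2) ∧
      Antitone (fun k => p (negOrder t k).1 * p (negOrder t k).2) := by
  have h01 : p 1 ≤ p 0 := hp (by decide)
  have h12 : p 2 ≤ p 1 := hp (by decide)
  have h23 : p 3 ≤ p 2 := hp (by decide)
  have right : ∀ i j k, p i ≤ p j → p i * p k ≤ p j * p k := fun _ _ _ h =>
    mul_le_mul_of_nonneg_right h (hp0 _)
  have left : ∀ i j k, p i ≤ p j → p k * p i ≤ p k * p j := fun _ _ _ h =>
    mul_le_mul_of_nonneg_left h (hp0 _)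
  have c1 := left 1 0 0 h01
  have c2 := left 2 1 0 h12
  have c3 := left 3 2 0 h23
  have c4 := right 1 0 1 h01
  have c5 := right 1 0 2 h01
  have c6 := right 1 0 3 h01
  have c7 := left 2 1 1 h12
  have c8 := left 3 2 1 h23
  have c9 := right 2 1 2 h12
  have c10 := right 2 1 3 h12
  have c11 := left 3 2 2 h23
  have c12 := right 3 2 3 h23
  -- Negative pairs have `j < i`; swapping the factors matches them with the comparisons above.
  suffices h : ∃ t, (∀ k : Fin 9, p (posOrder t k.succ).1 * p (posOrder t k.succ).2 ≤
        p (posOrder t k.castSucc).1 * p (posOrder t k.castSucc).2) ∧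
      ∀ k : Fin 5, p (negOrder t k.succ).2 * p (negOrder t k.succ).1 ≤
        p (negOrder t k.castSucc).2 * p (negOrder t k.castSucc).1 by
    obtain ⟨t, h1, h2⟩ := h
    refine ⟨t, Fin.antitone_iff_succ_le.2 h1, Fin.antitone_iff_succ_le.2 fun k => ?_⟩
    simpa only [mul_comm] using h2 k
  have d1 := le_total (p 1 * p 1) (p 0 * p 2)
  have d2 := le_total (p 2 * p 2) (p 1 * p 3)
  rcases le_total (p 1 * p 1) (p 0 * p 3) with h | h
  · rcases d2 with d2 | d2
    · refine ⟨0, ?_, ?_⟩ <;> intro k <;> fin_cases k <;> simp [posOrder, negOrder] <;> linarith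
    · refine ⟨1, ?_, ?_⟩ <;> intro k <;> fin_cases k <;> simp [posOrder, negOrder] <;> linarith
  rcases le_total (p 1 * p 2) (p 0 * p 3) with h' | h'
  · rcases d1 with d1 | d1 <;> rcases d2 with d2 | d2
    · refine ⟨10, ?_, ?_⟩ <;> intro k <;> fin_cases k <;> simp [posOrder, negOrder] <;> linarith
    · refine ⟨8, ?_, ?_⟩ <;> intro k <;> fin_cases k <;> simp [posOrder, negOrder] <;> linarith
    · refine ⟨11, ?_, ?_⟩ <;> intro k <;> fin_cases k <;> simp [posOrder, negOrder] <;> linarith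
    · refine ⟨9, ?_, ?_⟩ <;> intro k <;> fin_cases k <;> simp [posOrder, negOrder] <;> linarith
  rcases le_total (p 2 * p 2) (p 0 * p 3) with h'' | h''
  · rcases d1 with d1 | d1 <;> rcases d2 with d2 | d2
    · refine ⟨6, ?_, ?_⟩ <;> intro k <;> fin_cases k <;> simp [posOrder, negOrder] <;> linarith
    · refine ⟨4, ?_, ?_⟩ <;> intro k <;> fin_cases k <;> simp [posOrder, negOrder] <;> linarith
    · refine ⟨7, ?_, ?_⟩ <;> intro k <;> fin_cases k <;> simp [posOrder, negOrder] <;> linarith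
    · refine ⟨5, ?_, ?_⟩ <;> intro k <;> fin_cases k <;> simp [posOrder, negOrder] <;> linarith
  · rcases d1 with d1 | d1
    · refine ⟨2, ?_, ?_⟩ <;> intro k <;> fin_cases k <;> simp [posOrder, negOrder] <;> linarith
    · refine ⟨3, ?_, ?_⟩ <;> intro k <;> fin_cases k <;> simp [posOrder, negOrder] <;> linarith

/-! ### The main theorem -/

theorem isHermitian_partialTranspose {m n : ℕ} {X : Matrix (Fin m × Fin n) (Fin m × Fin n) ℂ}
    (hX : X.IsHermitian) : (partialTranspose X).IsHermitian := by
  ext x y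
  simp only [conjTranspose_apply, partialTranspose, of_apply]
  exact hX.apply _ _

/-- Unitarily conjugate matrices have the same unitary orbit, so only the spectrum matters. -/
theorem isAbsolutelyPPT_conj_iff {m n : ℕ} {V D : Matrix (Fin m × Fin n) (Fin m × Fin n) ℂ}
    (hV : V ∈ unitaryGroup (Fin m × Fin n) ℂ) :
    IsAbsolutelyPPT (V * D * Vᴴ) ↔
      ∀ W ∈ unitaryGroup (Fin m × Fin n) ℂ, IsPPT (W * D * Wᴴ) := by
  have hVV := mem_unitaryGroup_iff'.1 hV
  rw [star_eq_conjTranspose] at hVV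
  constructor
  · intro h W hW
    have := h (W * Vᴴ) (mul_mem hW (Unitary.star_mem hV))
    rw [conjTranspose_mul, conjTranspose_conjTranspose] at this
    convert this using 1
    calc W * D * Wᴴ = W * (Vᴴ * V) * D * (Vᴴ * V) * Wᴴ := by simp [hVV]
      _ = _ := by simp only [Matrix.mul_assoc]
  · intro h U hU
    have := h (U * V) (mul_mem hU hV)
    rw [conjTranspose_mul] at this
    convert this using 1
    simp only [Matrix.mul_assoc]

/-- The quadratic form of `X^Γ` at a vector with Schmidt coefficients `p`, ordered along a pattern. -/
theorem quadForm_partialTranspose_re {m n : ℕ}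
    (X : Matrix (Fin m × Fin n) (Fin m × Fin n) ℂ)
    (p : Fin 4 → ℝ) (e : Fin 4 → Fin m → ℂ) (f : Fin 4 → Fin n → ℂ)
    (ψ : Fin m × Fin n → ℂ) (hψ : ∀ x, ψ x = ∑ i, (p i : ℂ) * e i x.1 * f i x.2) (t : Fin 12) :
    (quadForm (partialTranspose X) ψ).re =
      ∑ k, p (posOrder t k).1 * p (posOrder t k).2 *
        (quadForm X (symmFamily e f (posOrder t k))).re -
      ∑ k, p (negOrder t k).1 * p (negOrder t k).2 *
        (quadForm X (symmFamily e f (negOrder t k))).re := by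
  have h : (quadForm (partialTranspose X) ψ).re = ∑ x : Fin 4 × Fin 4,
      (if x.1 ≤ x.2 then 1 else -1) * (p x.1 * p x.2) * (quadForm X (symmFamily e f x)).re := by
    rw [quadForm_partialTranspose_eq_sum_symmFamily X p e f ψ hψ, Complex.re_sum]
    refine Finset.sum_congr rfl fun x _ => ?_
    rw [← Complex.re_ofReal_mul]
    split_ifs <;> push_cast <;> rfl
  rw [h, sum_pairs_eq_sum_orders t, sub_eq_add_neg, ← Finset.sum_neg_distrib]
  congr 1
  · exact Finset.sum_congr rfl fun k _ => by rw [if_pos (le_posOrder t k)]; ring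
  · exact Finset.sum_congr rfl fun k _ => by rw [if_neg (negOrder_lt t k).not_ge]; ring

theorem isOrthonormalFamily_single {ι : Type*} [Fintype ι] [DecidableEq ι] :
    IsOrthonormalFamily fun i : ι => (Pi.single i 1 : ι → ℂ) := by
  intro i j
  simp [Pi.star_single, Pi.single_apply, eq_comm]

/-- A unitary carries eigenvectors onto the symmetric and antisymmetric vectors in the order of `t`;
evaluating at coefficients `p` then gives half the form of the pattern. No sign or ordering of `p`
is needed. -/
theorem lambdaMatrix_posSemidef_of_conj_diagonal {n : ℕ} (hn : 4 ≤ n) (lam : ℕ → ℝ)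
    (g : Fin 4 × Fin n ≃ Fin (4 * n))
    (h : ∀ W ∈ unitaryGroup (Fin 4 × Fin n) ℂ,
      IsPPT (W * diagonal (fun i => (lam (g i + 1) : ℂ)) * Wᴴ)) (t : Fin 12) :
    (LambdaMatrix n lam t).PosSemidef := by
  refine .of_dotProduct_mulVec_nonneg (isHermitian_lambdaPattern _ _ _) fun p => ?_
  rw [star_trivial, LambdaMatrix, dotProduct_lambdaPattern]
  set e : Fin 4 → Fin 4 → ℂ := fun i => Pi.single i 1
  have he : IsOrthonormalFamily e := isOrthonormalFamily_single
  set f : Fin 4 → Fin n → ℂ := fun i => Pi.single (Fin.castLE hn i) 1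
  have hf : IsOrthonormalFamily f := isOrthonormalFamily_single.comp (Fin.castLE_injective hn)
  -- Zero-based positions of the six largest and ten smallest eigenvalues; `4 * n ≥ 16` keeps them
  -- disjoint.
  set idx : Fin 6 ⊕ Fin 10 → Fin (4 * n) :=
    Sum.elim (fun k => ⟨k, by omega⟩) (fun k => ⟨4 * n - 1 - k, by omega⟩) with hidx
  have hinj : Function.Injective idx := by
    rintro (a | a) (b | b) hab <;> simp [hidx, Fin.ext_iff] at hab ⊢ <;> omega
  obtain ⟨W, hW, hcol⟩ := ((he.symmFamily hf).comp
    (sumElim_negOrder_posOrder_injective t)).exists_unitary (g.symm.injective.comp hinj)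
  set X := W * diagonal (fun i => (lam (g i + 1) : ℂ)) * Wᴴ with hX
  have hQ : ∀ s, (quadForm X (symmFamily e f (Sum.elim (negOrder t) (posOrder t) s))).re =
      lam (idx s + 1) := by
    intro s
    have h1 : symmFamily e f (Sum.elim (negOrder t) (posOrder t) s) =
        W *ᵥ Pi.single (g.symm (idx s)) 1 := by
      ext x
      simpa using (hcol s x).symm
    rw [hX, quadForm_conj_diagonal W (fun i => lam (g i + 1)), h1, mulVec_mulVec,
      ← star_eq_conjTranspose, mem_unitaryGroup_iff'.1 hW, one_mulVec, Complex.ofReal_re,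
      Finset.sum_eq_single (g.symm (idx s))]
    · simp
    · intro b _ hb
      simp [Pi.single_eq_of_ne hb]
    · simp
  have h2 := (Complex.nonneg_iff.1 ((h W hW).dotProduct_mulVec_nonneg
    (fun x => ∑ i, (p i : ℂ) * e i x.1 * f i x.2))).1
  change 0 ≤ (quadForm (partialTranspose X) _).re at h2
  rw [quadForm_partialTranspose_re X p e f _ (fun _ => rfl) t] at h2
  have hpos : ∀ k, (quadForm X (symmFamily e f (posOrder t k))).re = lam (4 * n - k) := by
    intro k
    refine (hQ (Sum.inr k)).trans (congrArg lam ?_)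
    simp only [hidx, Sum.elim_inr]
    omega
  have hneg : ∀ k, (quadForm X (symmFamily e f (negOrder t k))).re = lam (k + 1) :=
    fun k => hQ (Sum.inl k)
  simp only [hpos, hneg] at h2
  linarith

theorem isPPT_conj_diagonal_of_lambdaMatrix {n : ℕ} (hn : 4 ≤ n) {lam : ℕ → ℝ}
    (hlam : AntitoneOn lam (Set.Icc 1 (4 * n))) (g : Fin 4 × Fin n ≃ Fin (4 * n))
    (h : ∀ t, (LambdaMatrix n lam t).PosSemidef) {W : Matrix (Fin 4 × Fin n) (Fin 4 × Fin n) ℂ}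
    (hW : W ∈ unitaryGroup (Fin 4 × Fin n) ℂ) :
    IsPPT (W * diagonal (fun i => (lam (g i + 1) : ℂ)) * Wᴴ) := by
  set X := W * diagonal (fun i => (lam (g i + 1) : ℂ)) * Wᴴ with hX
  have hXh : X.IsHermitian := isHermitian_mul_mul_conjTranspose W
    (isHermitian_diagonal_of_self_adjoint _ (by ext; simp))
  have hP := isHermitian_partialTranspose hXh
  refine .of_dotProduct_mulVec_nonneg hP fun ψ => ?_
  rw [Complex.nonneg_iff]
  refine ⟨?_, (hP.im_star_dotProduct_mulVec_self ψ).symm⟩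
  change 0 ≤ (quadForm (partialTranspose X) ψ).re
  obtain ⟨p, e, f, hp, hp0, he, hf, hψ⟩ :=
    exists_schmidt_decomposition hn (Matrix.of fun a b => ψ (a, b))
  obtain ⟨t, hpos, hneg⟩ := exists_antitone_orders hp hp0
  rw [quadForm_partialTranspose_re X p e f ψ (fun x => hψ x.1 x.2) t]
  have hs := he.symmFamily hf
  have hio := (hs.comp (sumElim_negOrder_posOrder_injective t)).comp Sum.inl_injective
  have hjo := (hs.comp (sumElim_negOrder_posOrder_injective t)).comp Sum.inr_injective
  have hup := quadForm_le_sum_mul_initial (by omega : 6 ≤ 4 * n) g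
    (d := fun l => lam (l + 1)) (fun a b hab => hlam ⟨by omega, by omega⟩ ⟨by omega, by omega⟩
      (by simpa using hab)) hW hio hneg (fun k => mul_nonneg (hp0 _) (hp0 _))
  -- Reversing the enumeration makes the eigenvalues increase, so the initial terms are the ten
  -- smallest.
  have hlow := sum_mul_initial_le_quadForm (by omega : 10 ≤ 4 * n) (g.trans Fin.revPerm)
    (d := fun l => lam (4 * n - l)) (fun a b hab => hlam ⟨by omega, by omega⟩
      ⟨by omega, by omega⟩ (Nat.sub_le_sub_left hab _)) hW hjo hpos
    (fun k => mul_nonneg (hp0 _) (hp0 _))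
  have hrev : ∀ i, 4 * n - ((g.trans Fin.revPerm i : Fin (4 * n)) : ℕ) = g i + 1 := by
    intro i
    simp only [Equiv.trans_apply, Fin.revPerm_apply, Fin.val_rev]
    omega
  simp only [hrev] at hlow
  have hL := (h t).dotProduct_mulVec_nonneg p
  rw [star_trivial, LambdaMatrix, dotProduct_lambdaPattern] at hL
  simp only [Function.comp_apply, Sum.elim_inl, Sum.elim_inr, Fin.val_castLE, ← hX] at hup hlow
  linarith

theorem theorem1 (n : ℕ) (hn : 4 ≤ n)
    (ρ : Matrix (Fin 4 × Fin n) (Fin 4 × Fin n) ℂ) (hρ : IsMixedState ρ)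
    (lam : ℕ → ℝ) (hlam : IsDecreasingSpectrum ρ (4 * n) lam) :
    IsAbsolutelyPPT ρ ↔ ∀ t : Fin 12, (LambdaMatrix n lam t).PosSemidef := by
  obtain ⟨g, V, hV, rfl⟩ := hlam.exists_unitary_diagonal hρ.1.1
  rw [isAbsolutelyPPT_conj_iff hV]
  exact ⟨fun h => lambdaMatrix_posSemidef_of_conj_diagonal hn lam g h,
    fun h W hW => isPPT_conj_diagonal_of_lambdaMatrix hn hlam.1 g h hW⟩
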